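/- For nonzero integers $m, n$ let $BS(m,n)=\langle a,t \mid t^{-1}a^{m}t=a^{n}\rangle$ be the Baumslag--Solitar group, and call two groups commensurable if they have isomorphic subgroups of finite index. Let $n \geq 1$, $k>1$ and $l>1$ be integers. Then the groups $BS(k,kn)$ and $BS(l,ln)$ are commensurable. -/

import Mathlib

/-- The two generators of a Baumslag-Solitar group. -/
inductive BSGen : Type
  | a
  | t

/-- The single defining relator `t⁻¹ a ^ m t (a ^ n)⁻¹`, i.e. the relation
`t⁻¹ a ^ m t = a ^ n`. -/
def BSRelators (m n : ℤ) : Set (FreeGroup BSGen) :=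
  {(FreeGroup.of BSGen.t)⁻¹ * FreeGroup.of BSGen.a ^ m * FreeGroup.of BSGen.t *
    (FreeGroup.of BSGen.a ^ n)⁻¹}

/-- The Baumslag-Solitar group `BS(m, n) = ⟨a, t ∣ t⁻¹ a ^ m t = a ^ n⟩`
(of interest for nonzero `m` and `n`). -/
abbrev BS (m n : ℤ) : Type := PresentedGroup (BSRelators m n)

/-- Two groups are (abstractly) commensurable if they have isomorphic subgroups of
finite index. -/
def AbstractlyCommensurable (G₁ G₂ : Type*) [Group G₁] [Group G₂] : Prop :=
  ∃ (H₁ : Subgroup G₁) (H₂ : Subgroup G₂),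
    H₁.FiniteIndex ∧ H₂.FiniteIndex ∧ Nonempty (H₁ ≃* H₂)

/-!
Let `Q_J = ⟨b, t, s_j (j ∈ J) ∣ t⁻¹ b t = b ^ n, [s_j, b] = 1⟩` (`StableLetterGroup n J` below).
Both groups of the theorem contain, with finite index, a copy of a common group `Q_J`.

* The kernel of `BS(k, kn) → ℤ/k`, `a ↦ 1`, `t ↦ 0`, is generated by `b = a ^ k` and the
  conjugates `a⁻ⁱ t aⁱ`, `0 ≤ i < k`, each of which conjugates `b` to `b ^ n`. Writing
  `a⁻ⁱ t aⁱ = sᵢ t` shows that it is `Q_J` with `|J| = k - 1`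
  (`FiniteIndexEmbeds.stableLetterGroup_bs`).
* The kernel of the map `Q_J → ℤ/m` that sends one chosen `s = s_j₀` to `1` and the other generators
  to `0` is generated by `b`, `s ^ m` and the conjugates by powers of `s` of the remaining
  generators. Again `s⁻ⁱ t sⁱ = rᵢ t` with `rᵢ` commuting with `b`, so the kernel is `Q_J'` with
  `|J'| = 1 + (m - 1) + m (|J| - 1) = m |J|` (`FiniteIndexEmbeds.stableLetterGroup_prod`).

Taking `m = l - 1` over `BS(k, kn)` and `m = k - 1` over `BS(l, ln)` gives `|J'| = (k - 1)(l - 1)`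
in both cases.

In both steps the relations make the map `f : P → G` from the candidate presentation well defined.
It is injective because `G` acts on `ℤ/m × P` as it would act by left multiplication on
the union of the cosets `sⁱ P`: the letter `s` (`a` in the first step) moves one fibre to the next
(`cyclePerm`), the other generators multiply within the fibres (`fiberMul`), and `P` acts on the
fibre over `0` by left translation (`PresentedGroup.injective_of_perm`). Its range has finite index
because the generators permute the
cosets `sⁱ f(P)` (`finiteIndex_of_zpow_conj`).
-/

/-! ### Embeddings of finite index -/

/-- `P` is isomorphic to a subgroup of finite index of `G`. -/
def FiniteIndexEmbeds (P G : Type*) [Group P] [Group G] : Prop :=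
  ∃ f : P →* G, Function.Injective f ∧ f.range.FiniteIndex

theorem FiniteIndexEmbeds.trans {P Q G : Type*} [Group P] [Group Q] [Group G]
    (h₁ : FiniteIndexEmbeds P Q) (h₂ : FiniteIndexEmbeds Q G) : FiniteIndexEmbeds P G := by
  obtain ⟨f, hf, hfi⟩ := h₁
  obtain ⟨g, hg, hgi⟩ := h₂
  refine ⟨g.comp f, hg.comp hf, ⟨?_⟩⟩
  rw [MonoidHom.range_comp, Subgroup.index_map_of_injective _ hg]
  exact mul_ne_zero hfi.index_ne_zero hgi.index_ne_zero

theorem FiniteIndexEmbeds.abstractlyCommensurable {P G₁ G₂ : Type*} [Group P] [Group G₁]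
    [Group G₂] (h₁ : FiniteIndexEmbeds P G₁) (h₂ : FiniteIndexEmbeds P G₂) :
    AbstractlyCommensurable G₁ G₂ := by
  obtain ⟨f, hf, hfi⟩ := h₁
  obtain ⟨g, hg, hgi⟩ := h₂
  exact ⟨f.range, g.range, hfi, hgi,
    ⟨(MonoidHom.ofInjective hf).symm.trans (MonoidHom.ofInjective hg)⟩⟩

theorem exists_zpow_eq_pow_mul_zpow {G : Type*} [Group G] (s : G) (m : ℕ) (i : ℤ) :
    ∃ (r : Fin (m + 1)) (c : ℤ), s ^ i = s ^ (r : ℕ) * (s ^ (m + 1)) ^ c := by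
  have hpos : (0 : ℤ) < (m : ℤ) + 1 := by omega
  have hlt := Int.emod_lt_of_pos i hpos
  obtain ⟨r, hr⟩ := Int.eq_ofNat_of_zero_le (Int.emod_nonneg i hpos.ne')
  refine ⟨⟨r, by omega⟩, i / ((m : ℤ) + 1), ?_⟩
  have hdm := Int.emod_add_mul_ediv i ((m : ℤ) + 1)
  rw [← zpow_natCast s (m + 1), ← zpow_mul, ← zpow_natCast s r, ← zpow_add]
  congr 1
  push_cast
  omega

/-- A subgroup `H` containing `s ^ (m + 1)` has finite index as soon as each generator of `G`
shifts all the cosets `sⁱ H` by a constant amount `e`. -/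
theorem finiteIndex_of_zpow_conj {G : Type*} [Group G] {S : Set G} (hS : Subgroup.closure S = ⊤)
    (H : Subgroup G) (s : G) (m : ℕ) (hs : s ^ (m + 1) ∈ H)
    (h : ∀ x ∈ S, ∃ e : ℤ, ∀ i : ℤ, s ^ (-(i + e)) * x * s ^ i ∈ H) : H.FiniteIndex := by
  have key : ∀ g : G, ∃ e : ℤ, ∀ i : ℤ, s ^ (-(i + e)) * g * s ^ i ∈ H := by
    intro g
    have hg : g ∈ Subgroup.closure S := hS ▸ Subgroup.mem_top g
    induction hg using Subgroup.closure_induction with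
    | mem x hx => exact h x hx
    | one => exact ⟨0, fun i => by simp⟩
    | mul x y _ _ hx hy =>
      obtain ⟨e, he⟩ := hx
      obtain ⟨d, hd⟩ := hy
      refine ⟨d + e, fun i => ?_⟩
      convert H.mul_mem (he (i + d)) (hd i) using 1
      rw [← add_assoc, zpow_neg s (i + d)]
      group
    | inv x _ hx =>
      obtain ⟨e, he⟩ := hx
      refine ⟨-e, fun i => ?_⟩
      convert H.inv_mem (he (i + -e)) using 1
      group
  have hsurj : Function.Surjective
      (fun i : Fin (m + 1) => (QuotientGroup.mk (s ^ (i : ℕ)) : G ⧸ H)) := by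
    intro q
    obtain ⟨g, rfl⟩ := QuotientGroup.mk_surjective q
    obtain ⟨e, he⟩ := key g
    obtain ⟨r, c, hrc⟩ := exists_zpow_eq_pow_mul_zpow s m e
    refine ⟨r, QuotientGroup.eq.2 ?_⟩
    convert H.mul_mem (H.zpow_mem hs c) (he 0) using 1
    rw [zero_add, zpow_neg, hrc]
    group
  have : Finite (G ⧸ H) := Finite.of_surjective _ hsurj
  exact Subgroup.finiteIndex_of_finite_quotient

/-- Conjugates by arbitrary powers of `s` may be checked for the exponents `0, …, m` only. -/
theorem zpow_conj_mem {G : Type*} [Group G] (H : Subgroup G) (s x : G) (m : ℕ)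
    (hs : s ^ (m + 1) ∈ H)
    (h : ∀ r : Fin (m + 1), (s ^ (r : ℕ))⁻¹ * x * s ^ (r : ℕ) ∈ H) (i : ℤ) :
    s ^ (-(i + 0)) * x * s ^ i ∈ H := by
  obtain ⟨r, c, hrc⟩ := exists_zpow_eq_pow_mul_zpow s m i
  have hc := H.zpow_mem hs c
  convert H.mul_mem (H.mul_mem (H.inv_mem hc) (h r)) hc using 1
  rw [add_zero, zpow_neg, hrc]
  group

/-! ### Permutations of `Fin (m + 1) × P` -/

/-- Left multiplication by `c i` in the fibre over `i`. -/
def fiberMul (ι P : Type*) [Group P] : (ι → P) →* Equiv.Perm (ι × P) where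
  toFun c := Equiv.prodShear (Equiv.refl ι) fun i => Equiv.mulLeft (c i)
  map_one' := by ext x <;> simp
  map_mul' c d := by ext x <;> simp

@[simp]
theorem fiberMul_apply {ι P : Type*} [Group P] (c : ι → P) (i : ι) (q : P) :
    fiberMul ι P c (i, q) = (i, c i * q) := rfl

@[simp]
theorem fiberMul_inv_apply {ι P : Type*} [Group P] (c : ι → P) (i : ι) (q : P) :
    (fiberMul ι P c)⁻¹ (i, q) = (i, (c i)⁻¹ * q) := by
  rw [← map_inv]
  rfl

/-- The permutation moving each fibre of `Fin (m + 1) × P` to the next one, with an additional left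
multiplication by `u` on the way from the last fibre to the fibre over `0`. -/
def cyclePerm {P : Type*} [Group P] (m : ℕ) (u : P) : Equiv.Perm (Fin (m + 1) × P) :=
  (fiberMul (Fin (m + 1)) P fun i => if i = Fin.last m then u else 1).trans
    (Equiv.prodCongr (Equiv.addRight 1) (Equiv.refl P))

section cyclePerm

variable {P : Type*} [Group P] {m : ℕ}

theorem cyclePerm_apply (u : P) (i : Fin (m + 1)) (q : P) :
    cyclePerm m u (i, q) = (i + 1, (if i = Fin.last m then u else 1) * q) := rfl

theorem cyclePerm_pow_apply_zero (u : P) (q : P) (i : Fin (m + 1)) :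
    (cyclePerm m u ^ (i : ℕ)) (0, q) = (i, q) := by
  induction i using Fin.induction with
  | zero => simp
  | succ i ih =>
    rw [Fin.val_castSucc] at ih
    rw [Fin.val_succ, pow_succ', Equiv.Perm.mul_apply, ih, cyclePerm_apply,
      if_neg (Fin.castSucc_lt_last i).ne, one_mul, Fin.coeSucc_eq_succ]

theorem cyclePerm_pow_inv_apply (u : P) (q : P) (i : Fin (m + 1)) :
    (cyclePerm m u ^ (i : ℕ))⁻¹ (i, q) = (0, q) := by
  rw [Equiv.Perm.inv_eq_iff_eq, cyclePerm_pow_apply_zero]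

theorem cyclePerm_pow_succ (u : P) :
    cyclePerm m u ^ (m + 1) = fiberMul (Fin (m + 1)) P fun _ => u := by
  have h0 : ∀ q, (cyclePerm m u ^ (m + 1)) (0, q) = (0, u * q) := by
    intro q
    have h := cyclePerm_pow_apply_zero u q (Fin.last m)
    rw [Fin.val_last] at h
    rw [pow_succ', Equiv.Perm.mul_apply, h, cyclePerm_apply, if_pos rfl, Fin.last_add_one]
  ext1 ⟨i, q⟩
  -- The claim holds over `0`; elsewhere, transport it by a power of the permutation itself.
  rw [fiberMul_apply, ← cyclePerm_pow_apply_zero u q i, ← Equiv.Perm.mul_apply,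
    (Commute.pow_pow_self _ _ _).eq, Equiv.Perm.mul_apply, h0, cyclePerm_pow_apply_zero]

theorem commute_cyclePerm_fiberMul {u b : P} (h : Commute u b) :
    Commute (cyclePerm m u) (fiberMul (Fin (m + 1)) P fun _ => b) := by
  ext1 ⟨i, q⟩
  simp only [Equiv.Perm.mul_apply, fiberMul_apply, cyclePerm_apply]
  split_ifs
  · rw [← mul_assoc, ← mul_assoc, h.eq]
  · simp

end cyclePerm

/-- A homomorphism `f` from a presented group `P` is injective if its target acts on `ι × P` in such
a way that the image of every generator acts on one fibre as left translation by that generator. -/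
theorem PresentedGroup.injective_of_perm {α ι G : Type*} [Group G] {rels : Set (FreeGroup α)}
    (f : PresentedGroup rels →* G) (θ : G →* Equiv.Perm (ι × PresentedGroup rels)) (i₀ : ι)
    (h : ∀ x q, θ (f (PresentedGroup.of x)) (i₀, q) = (i₀, PresentedGroup.of x * q)) :
    Function.Injective f := by
  have key : ∀ p q : PresentedGroup rels, θ (f p) (i₀, q) = (i₀, p * q) := by
    intro p
    have hp : p ∈ Subgroup.closure (Set.range (PresentedGroup.of (rels := rels))) := by
      rw [PresentedGroup.closure_range_of]
      exact Subgroup.mem_top p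
    induction hp using Subgroup.closure_induction with
    | mem x hx =>
      obtain ⟨x, rfl⟩ := hx
      exact h x
    | one => simp
    | mul x y _ _ hx hy =>
      intro q
      rw [map_mul, map_mul, Equiv.Perm.mul_apply, hy, hx, mul_assoc]
    | inv x _ hx =>
      intro q
      rw [map_inv, map_inv, Equiv.Perm.inv_eq_iff_eq, hx, mul_inv_cancel_left]
  intro p p' hpp
  have h1 := key p 1
  rw [hpp, key p' 1] at h1
  simpa using (congrArg Prod.snd h1).symm

/-! ### The groups `⟨b, t, s_j ∣ t⁻¹ b t = b ^ n, [s_j, b] = 1⟩` -/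

/-- The generators `b`, `t` and `s j`, for `j : J`, of `StableLetterGroup n J`. -/
inductive StableLetterGen (J : Type) : Type
  | b
  | t
  | s (j : J)

/-- The relators expressing `t⁻¹ b t = b ^ n` and `s j * b = b * s j` for all `j`. -/
def stableLetterRelators (n : ℤ) (J : Type) : Set (FreeGroup (StableLetterGen J)) :=
  {(FreeGroup.of .t)⁻¹ * FreeGroup.of .b * FreeGroup.of .t * (FreeGroup.of .b ^ n)⁻¹} ∪
    Set.range fun j => FreeGroup.of (.s j) * FreeGroup.of .b * (FreeGroup.of (.s j))⁻¹ *
      (FreeGroup.of .b)⁻¹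

/-- The group `⟨b, t, s_j (j ∈ J) ∣ t⁻¹ b t = b ^ n, [s_j, b] = 1⟩`. Replacing `s_j` by `s_j t`, it
is the fundamental group of a rose of `|J| + 1` loops with infinite cyclic vertex and edge groups,
all the loops having the labels `1` and `n`. -/
abbrev StableLetterGroup (n : ℤ) (J : Type) : Type := PresentedGroup (stableLetterRelators n J)

namespace StableLetterGroup

variable {n : ℤ} {J : Type}

/-- The generator `b`. -/
def b : StableLetterGroup n J := PresentedGroup.of .b

/-- The generator `t`. -/
def t : StableLetterGroup n J := PresentedGroup.of .t

/-- The generator `s j`. -/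
def s (j : J) : StableLetterGroup n J := PresentedGroup.of (.s j)

theorem t_inv_mul_b_mul_t : (t⁻¹ * b * t : StableLetterGroup n J) = b ^ n := by
  rw [← mul_inv_eq_one]
  exact PresentedGroup.one_of_mem (Or.inl rfl)

theorem commute_s_b (j : J) : Commute (s j : StableLetterGroup n J) b := by
  have h : (s j * b * (s j)⁻¹ * b⁻¹ : StableLetterGroup n J) = 1 :=
    PresentedGroup.one_of_mem (Or.inr ⟨j, rfl⟩)
  rw [mul_inv_eq_one, mul_inv_eq_iff_eq_mul] at h
  exact h

/-- The universal property of `StableLetterGroup n J`. -/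
def lift {G : Type*} [Group G] (b' t' : G) (s' : J → G) (ht : t'⁻¹ * b' * t' = b' ^ n)
    (hs : ∀ j, Commute (s' j) b') : StableLetterGroup n J →* G :=
  PresentedGroup.toGroup
    (f := fun x : StableLetterGen J =>
      match x with
      | .b => b'
      | .t => t'
      | .s j => s' j) <| by
    rintro r (rfl | ⟨j, rfl⟩)
    · simp [ht]
    · simp [(hs j).eq]

section lift

variable {G : Type*} [Group G] (b' t' : G) (s' : J → G) (ht : t'⁻¹ * b' * t' = b' ^ n)
    (hs : ∀ j, Commute (s' j) b')

@[simp]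
theorem lift_b : lift b' t' s' ht hs b = b' := PresentedGroup.toGroup.of _

@[simp]
theorem lift_t : lift b' t' s' ht hs t = t' := PresentedGroup.toGroup.of _

@[simp]
theorem lift_s (j : J) : lift b' t' s' ht hs (s j) = s' j := PresentedGroup.toGroup.of _

end lift

/-- Left multiplication of `t` by an element commuting with `b` preserves the relation between `t`
and `b`. -/
theorem conj_b_of_commute {x : StableLetterGroup n J} (hx : Commute x b) :
    (x * t)⁻¹ * b * (x * t) = b ^ n := by
  rw [← t_inv_mul_b_mul_t, mul_inv_rev]
  have := hx.inv_left.eq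
  calc t⁻¹ * x⁻¹ * b * (x * t) = t⁻¹ * (x⁻¹ * b) * x * t := by group
    _ = t⁻¹ * b * t := by rw [this]; group

/-- The homomorphism induced by a map between the index sets. -/
def relabel {J' : Type} (e : J → J') : StableLetterGroup n J →* StableLetterGroup n J' :=
  lift b t (fun j => s (e j)) t_inv_mul_b_mul_t fun _ => commute_s_b _

theorem leftInverse_relabel {J' : Type} {e : J → J'} {e' : J' → J}
    (h : Function.LeftInverse e' e) :
    Function.LeftInverse (relabel e' : StableLetterGroup n J' →* _) (relabel e) := by
  have hcomp : (relabel e').comp (relabel e) = MonoidHom.id (StableLetterGroup n J) := by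
    refine PresentedGroup.ext fun x => ?_
    match x with
    | .b =>
      change relabel e' (relabel e b) = b
      simp [relabel]
    | .t =>
      change relabel e' (relabel e t) = t
      simp [relabel]
    | .s j =>
      change relabel e' (relabel e (s j)) = s j
      simp [relabel, h j]
  exact fun x => DFunLike.congr_fun hcomp x

theorem embeds_of_equiv {J' : Type} (e : J ≃ J') :
    FiniteIndexEmbeds (StableLetterGroup n J) (StableLetterGroup n J') := by
  refine ⟨relabel e, (leftInverse_relabel e.symm_apply_apply).injective, ?_⟩
  rw [MonoidHom.range_eq_top.2 (leftInverse_relabel e.apply_symm_apply).surjective]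
  infer_instance

end StableLetterGroup

/-- If `t` conjugates `b` into a subgroup centralized by `x`, then `x⁻¹ t x t⁻¹` commutes
with `b`. -/
theorem commute_conj_mul_inv {G : Type*} [Group G] {x t b : G} {n : ℤ} (ht : t⁻¹ * b * t = b ^ n)
    (hx : Commute x b) : Commute (x⁻¹ * t * x * t⁻¹) b := by
  have h1 : t⁻¹ * b = b ^ n * t⁻¹ := by rw [← ht]; group
  have h2 : t * b ^ n = b * t := by rw [← ht]; group
  change x⁻¹ * t * x * t⁻¹ * b = b * (x⁻¹ * t * x * t⁻¹)
  calc x⁻¹ * t * x * t⁻¹ * b = x⁻¹ * t * x * (t⁻¹ * b) := by group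
    _ = x⁻¹ * t * (x * b ^ n) * t⁻¹ := by rw [h1]; group
    _ = x⁻¹ * (t * b ^ n) * x * t⁻¹ := by rw [(hx.zpow_right n).eq]; group
    _ = (x⁻¹ * b) * t * x * t⁻¹ := by rw [h2]; group
    _ = b * (x⁻¹ * t * x * t⁻¹) := by rw [hx.inv_left.eq]; group

/-! ### The cyclic cover of a Baumslag-Solitar group -/

open StableLetterGroup in
/-- `StableLetterGroup n (Fin p)` as the kernel of `BS(p + 1, (p + 1) n) → ℤ/(p + 1)`, `a ↦ 1`,
`t ↦ 0`. -/
theorem FiniteIndexEmbeds.stableLetterGroup_bs (n : ℤ) (p : ℕ) :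
    FiniteIndexEmbeds (StableLetterGroup n (Fin p))
      (BS ((p + 1 : ℕ) : ℤ) (((p + 1 : ℕ) : ℤ) * n)) := by
  set G := BS ((p + 1 : ℕ) : ℤ) (((p + 1 : ℕ) : ℤ) * n)
  let P := StableLetterGroup n (Fin p)
  let a' : G := PresentedGroup.of BSGen.a
  let t' : G := PresentedGroup.of BSGen.t
  have hrel : t'⁻¹ * a' ^ (p + 1) * t' = (a' ^ (p + 1)) ^ n := by
    rw [← zpow_natCast a' (p + 1), ← zpow_mul, ← mul_inv_eq_one]
    exact PresentedGroup.one_of_mem rfl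
  let f : P →* G := lift (a' ^ (p + 1)) t'
    (fun i => (a' ^ (i.succ : ℕ))⁻¹ * t' * a' ^ (i.succ : ℕ) * t'⁻¹) hrel
    fun i => commute_conj_mul_inv hrel (Commute.pow_pow_self a' _ _)
  -- In the fibre over `i`, the letter `t` acts as the element `a⁻ⁱ t aⁱ = σ i * t` of the kernel.
  let σ : Fin (p + 1) → P := Fin.cases 1 s
  have hσ : ∀ i, Commute (σ i) b := Fin.cases (Commute.one_left _) commute_s_b
  let T := fiberMul (Fin (p + 1)) P fun i => σ i * t
  let A := cyclePerm p (b : P)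
  let θ : G →* Equiv.Perm (Fin (p + 1) × P) := PresentedGroup.toGroup
    (f := fun x : BSGen =>
      match x with
      | .a => A
      | .t => T) <| by
    rintro r rfl
    simp only [map_mul, map_inv, map_zpow, FreeGroup.lift_apply_of, mul_inv_eq_one]
    rw [zpow_mul, zpow_natCast, cyclePerm_pow_succ, ← map_inv, ← map_mul, ← map_mul, ← map_zpow]
    congr 1
    funext i
    exact conj_b_of_commute (hσ i)
  have hθa : θ a' = A := PresentedGroup.toGroup.of _
  have hθt : θ t' = T := PresentedGroup.toGroup.of _
  refine ⟨f, PresentedGroup.injective_of_perm f θ 0 ?_, ?_⟩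
  · intro x q
    match x with
    | .b =>
      have h1 : f (PresentedGroup.of .b) = a' ^ (p + 1) := lift_b ..
      rw [h1, map_pow, hθa, cyclePerm_pow_succ]
      rfl
    | .t =>
      have h1 : f (PresentedGroup.of .t) = t' := lift_t ..
      rw [h1, hθt, fiberMul_apply]
      exact congrArg (Prod.mk 0) (congrArg (· * q) (one_mul _))
    | .s i =>
      have h1 : f (PresentedGroup.of (.s i)) =
        (a' ^ (i.succ : ℕ))⁻¹ * t' * a' ^ (i.succ : ℕ) * t'⁻¹ := lift_s ..
      rw [h1]
      simp only [map_mul, map_inv, map_pow, hθa, hθt, Equiv.Perm.mul_apply, T, A,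
        fiberMul_inv_apply, cyclePerm_pow_apply_zero, fiberMul_apply, cyclePerm_pow_inv_apply]
      have h2 : σ 0 = 1 := rfl
      have h3 : σ i.succ = PresentedGroup.of (.s i) := rfl
      rw [h2, h3, one_mul, mul_assoc, mul_inv_cancel_left]
  · have hmem : a' ^ (p + 1) ∈ f.range := ⟨b, lift_b ..⟩
    refine finiteIndex_of_zpow_conj (PresentedGroup.closure_range_of _) f.range a' p hmem ?_
    rintro _ ⟨x, rfl⟩
    match x with
    | .a =>
      refine ⟨1, fun i => ?_⟩
      change a' ^ (-(i + 1)) * a' * a' ^ i ∈ f.range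
      have : a' ^ (-(i + 1)) * a' * a' ^ i = 1 := by group
      exact this ▸ one_mem _
    | .t =>
      refine ⟨0, zpow_conj_mem f.range a' t' p hmem fun r => ?_⟩
      have ht : t' ∈ f.range := ⟨t, lift_t ..⟩
      refine Fin.cases ?_ (fun i => ?_) r
      · simpa using ht
      · have h1 : (a' ^ (i.succ : ℕ))⁻¹ * t' * a' ^ (i.succ : ℕ) * t'⁻¹ ∈ f.range :=
          ⟨s i, lift_s ..⟩
        simpa only [inv_mul_cancel_right] using mul_mem h1 ht

/-! ### Cyclic covers unwinding one commuting letter -/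

open StableLetterGroup in
/-- `StableLetterGroup n (Fin (m + 1) × J)` as the kernel of the map
`StableLetterGroup n J → ℤ/(m + 1)` with `s j₀ ↦ 1` and all other generators `↦ 0`. -/
theorem FiniteIndexEmbeds.stableLetterGroup_prod (n : ℤ) (m : ℕ) {J : Type} (j₀ : J) :
    FiniteIndexEmbeds (StableLetterGroup n (Fin (m + 1) × J)) (StableLetterGroup n J) := by
  classical
  set G := StableLetterGroup n J
  let P := StableLetterGroup n (Fin (m + 1) × J)
  let c : G := s j₀
  have hc : Commute c b := commute_s_b j₀
  -- The letter `(i, j)` stands for `c⁻ⁱ s_j cⁱ` if `j ≠ j₀`, and `(i, j₀)` for `c⁻ⁱ t cⁱ t⁻¹` if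
  -- `i ≠ 0`. The latter is trivial for `i = 0`, which leaves `(0, j₀)` free to stand for `cᵐ⁺¹`.
  let S : Fin (m + 1) × J → G := fun x =>
    if x.2 = j₀ then
      if x.1 = 0 then c ^ (m + 1) else (c ^ (x.1 : ℕ))⁻¹ * t * c ^ (x.1 : ℕ) * t⁻¹
    else (c ^ (x.1 : ℕ))⁻¹ * s x.2 * c ^ (x.1 : ℕ)
  have hS : ∀ x, Commute (S x) b := by
    intro x
    simp only [S]
    split_ifs
    · exact hc.pow_left _
    · exact commute_conj_mul_inv t_inv_mul_b_mul_t (hc.pow_left _)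
    · exact (((hc.pow_left _).inv_left).mul_left (commute_s_b _)).mul_left (hc.pow_left _)
  let f : P →* G := lift b t S t_inv_mul_b_mul_t hS
  let ρ : Fin (m + 1) → P := fun i => if i = 0 then 1 else s (i, j₀)
  have hρ : ∀ i, Commute (ρ i) b := by
    intro i
    simp only [ρ]
    split_ifs
    · exact Commute.one_left _
    · exact commute_s_b _
  let B := fiberMul (Fin (m + 1)) P fun _ => b
  let T := fiberMul (Fin (m + 1)) P fun i => ρ i * t
  let C := cyclePerm m (s (0, j₀) : P)
  let D : J → Equiv.Perm (Fin (m + 1) × P) := fun j =>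
    if j = j₀ then C else fiberMul (Fin (m + 1)) P fun i => s (i, j)
  have hT : T⁻¹ * B * T = B ^ n := by
    simp only [T, B]
    rw [← map_inv, ← map_mul, ← map_mul, ← map_zpow]
    congr 1
    funext i
    exact conj_b_of_commute (hρ i)
  have hD : ∀ j, Commute (D j) B := by
    intro j
    simp only [D]
    split_ifs
    · exact commute_cyclePerm_fiberMul (commute_s_b _)
    · exact Commute.map (funext fun i => (commute_s_b (i, j)).eq) _
  let θ : G →* Equiv.Perm (Fin (m + 1) × P) := lift B T D hT hD
  have hθb : θ b = B := lift_b ..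
  have hθt : θ t = T := lift_t ..
  have hθs : ∀ j, θ (s j) = D j := fun j => lift_s ..
  have hθc : θ c = C := (hθs j₀).trans (if_pos rfl)
  have hfs : ∀ x, f (s x) = S x := fun x => lift_s ..
  refine ⟨f, PresentedGroup.injective_of_perm f θ 0 ?_, ?_⟩
  · intro x q
    match x with
    | .b =>
      have h1 : f (PresentedGroup.of .b) = b := lift_b ..
      rw [h1, hθb]
      rfl
    | .t =>
      have h1 : f (PresentedGroup.of .t) = t := lift_t ..
      rw [h1, hθt, fiberMul_apply]
      exact congrArg (Prod.mk 0) (congrArg (· * q) (one_mul _))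
    | .s (i, j) =>
      change θ (f (s (i, j))) (0, q) = (0, s (i, j) * q)
      rw [hfs]
      by_cases hj : j = j₀
      · subst hj
        by_cases hi : i = 0
        · subst hi
          simp only [S, if_true, map_pow, hθc, C]
          rw [cyclePerm_pow_succ, fiberMul_apply]
        · simp only [S, if_true, if_neg hi, map_mul, map_inv, map_pow, hθc, hθt,
            Equiv.Perm.mul_apply, T, C, fiberMul_inv_apply, cyclePerm_pow_apply_zero,
            fiberMul_apply, cyclePerm_pow_inv_apply]
          simp only [ρ, if_true, if_neg hi]
          rw [one_mul, mul_assoc, mul_inv_cancel_left]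
      · simp only [S, if_neg hj, map_mul, map_inv, map_pow, hθc, hθs, Equiv.Perm.mul_apply, D, C,
          cyclePerm_pow_apply_zero, fiberMul_apply, cyclePerm_pow_inv_apply]
  · have hmem : c ^ (m + 1) ∈ f.range := ⟨s (0, j₀), by simp [hfs, S]⟩
    refine finiteIndex_of_zpow_conj (PresentedGroup.closure_range_of _) f.range c m hmem ?_
    rintro _ ⟨x, rfl⟩
    match x with
    | .b =>
      refine ⟨0, zpow_conj_mem f.range c b m hmem fun r => ⟨b, ?_⟩⟩
      rw [(hc.pow_left _).inv_left.eq, inv_mul_cancel_right]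
      exact lift_b ..
    | .t =>
      refine ⟨0, zpow_conj_mem f.range c t m hmem fun r => ?_⟩
      have ht : t ∈ f.range := ⟨t, lift_t ..⟩
      by_cases hr : r = 0
      · subst hr
        simpa using ht
      · have h1 : (c ^ (r : ℕ))⁻¹ * t * c ^ (r : ℕ) * t⁻¹ ∈ f.range :=
          ⟨s (r, j₀), by simp [hfs, S, hr]⟩
        simpa only [inv_mul_cancel_right] using mul_mem h1 ht
    | .s j =>
      by_cases hj : j = j₀
      · subst hj
        refine ⟨1, fun i => ?_⟩
        change c ^ (-(i + 1)) * c * c ^ i ∈ f.range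
        have : c ^ (-(i + 1)) * c * c ^ i = 1 := by group
        exact this ▸ one_mem _
      · exact ⟨0, zpow_conj_mem f.range c (s j) m hmem fun r =>
          ⟨s (r, j), by simp [hfs, S, hj]⟩⟩

/-! ### Commensurability -/

theorem lemma6p2 (n k l : ℤ) (hn : 1 ≤ n) (hk : 1 < k) (hl : 1 < l) :
    AbstractlyCommensurable (BS k (k * n)) (BS l (l * n)) := by
  obtain ⟨p, rfl⟩ : ∃ p : ℕ, k = ((p + 1 + 1 : ℕ) : ℤ) := ⟨(k - 2).toNat, by omega⟩
  obtain ⟨q, rfl⟩ : ∃ q : ℕ, l = ((q + 1 + 1 : ℕ) : ℤ) := ⟨(l - 2).toNat, by omega⟩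
  have h₁ := (FiniteIndexEmbeds.stableLetterGroup_prod n q (0 : Fin (p + 1))).trans
    (.stableLetterGroup_bs n (p + 1))
  have h₂ := (FiniteIndexEmbeds.stableLetterGroup_prod n p (0 : Fin (q + 1))).trans
    (.stableLetterGroup_bs n (q + 1))
  exact h₁.abstractlyCommensurable
    ((StableLetterGroup.embeds_of_equiv (Equiv.prodComm _ _)).trans h₂)
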